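/- Let $G$ be a finite connected plane bipartite graph (parallel edges allowed) with color classes $E$ and $V$ and with at least one edge, embedded in the oriented sphere. Its root polytope is $Q_G=\operatorname{Conv}\{\mathbf e+\mathbf v : ev \text{ is an edge of } G\}\subset\mathbb R^E\oplus\mathbb R^V$, where $\mathbf e,\mathbf v$ are the standard generators. Let $G^*$ be the planar dual graph, each edge of it being directed so that it has an element of $E$ on its right and an element of $V$ on its left. Fix a vertex (root) $r_0$ of $G^*$. An arborescence is a set $A$ of edges of $G^*$ whose connected component containing $r_0$ (the root component) is a tree with a directed path from $r_0$ to each of its vertices, and all of whose other components are isolated points; it is spanning if there are no isolated points outside the root component. To a spanning arborescence $A$ associate the simplex $\sigma_A\subset Q_G$ spanned by the points $\mathbf e+\mathbf v$ for all edges $ev$ of $G$ that are not crossed by an element of $A$ (these edges form a spanning tree of $G$). Fix also an edge $\kappa$ of $G$ whose dual edge $\kappa^*$ points to $r_0$. The tree of arborescences is the rooted binary tree with nodes labelled by pairs $(A,S)$, where $A$ is an arborescence and $S$ is a set of (skipped) edges of $G^*$, that is defined as follows. The root is $(\varnothing,\varnothing)$. Given a node $(A,S)$, go counterclockwise around the boundary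 of the regular neighborhood of the root component of $A$, starting where it is crossed by the half of $\kappa^*$ at $r_0$, until the first edge $\delta$ of $G^*$ is met such that $\delta\notin A\cup S$ and $A\cup\{\delta\}$ is an arborescence. If there is no such $\delta$, the node is a leaf; otherwise its right descendant is $(A\cup\{\delta\},S)$ and its left descendant is $(A,S\cup\{\delta\})$. Then the simplices $\sigma_A$, for the spanning arborescences $A$ rooted at $r_0$, are the maximal simplices of a triangulation of $Q_G$: they have the dimension of $Q_G$, their vertices are vertices of $Q_G$, their union is $Q_G$, and any two of them intersect in a common face. For every such $\kappa$, the sequence of the simplices $\sigma_A$ for those leaves $(A,S)$ of the tree of arborescences in which $A$ is spanning, taken from right to left, is a shelling order of this triangulation: it lists every maximal simplex exactly once, and each simplex in it but the first intersects the union of the preceding ones in the union of a positive number of its codimension one faces. In particular, these triangulations of $Q_G$ are shellable. -/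

import Mathlib

/-!
# Root polytopes of plane bipartite graphs and the tree of arborescences

A connected plane bipartite graph is encoded by its rotation system, which determines the embedding
into the oriented sphere up to isotopy; sphericity is Euler's formula.
-/

/-! ## Finite directed multigraphs, given by the endpoint maps of their edges -/

section Multigraph

variable {X C : Type*}

/-- The vertices `x` and `y` lie in the same connected component of the subgraph with edge set `A`
(directions are ignored), in the multigraph whose edge `c` goes from `s c` to `t c`. -/
def JoinedBy (s t : C → X) (A : Finset C) : X → X → Prop :=
  Relation.ReflTransGen
    fun x y => ∃ c ∈ A, (s c = x ∧ t c = y) ∨ (s c = y ∧ t c = x)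

/-- There is a directed path from `x` to `y` with edges in `A`. -/
def ReachableBy (s t : C → X) (A : Finset C) : X → X → Prop :=
  Relation.ReflTransGen fun x y => ∃ c ∈ A, s c = x ∧ t c = y

/-- `A` is an arborescence rooted at `r`. Its root component is the set of the vertices that are
joined to `r` by `A`. -/
structure IsArborescence [DecidableEq C] (s t : C → X) (r : X) (A : Finset C) : Prop where
  /-- Every edge lies in the root component: all other components are isolated points. -/
  edge_mem : ∀ c ∈ A, JoinedBy s t A r (s c)
  /-- There are no cycles (nor loops): the ends of an edge fall apart when it is removed. -/
  acyclic : ∀ c ∈ A, ¬ JoinedBy s t (A.erase c) (s c) (t c)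
  /-- There is a directed path from `r` to each vertex of the root component; it is unique because
  the root component is a tree. -/
  reachable : ∀ x, JoinedBy s t A r x → ReachableBy s t A r x

/-- A spanning arborescence is an arborescence whose root component contains all vertices. -/
structure IsSpanningArborescence [DecidableEq C] (s t : C → X) (r : X) (A : Finset C) : Prop
    extends IsArborescence s t r A where
  spanning : ∀ x, JoinedBy s t A r x

end Multigraph

/-! ## Triangulations and shellings -/

section Polytope

variable {W : Type*} [AddCommGroup W] [Module ℝ W]

/-- A set `T` of simplices, given by their vertex sets, is a triangulation of the polytope `Q`:
they are simplices of the dimension of `Q`, whose vertices are vertices of `Q`, their union is `Q`,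
and any two of them intersect in a common face. -/
structure IsTriangulation (Q : Set W) (T : Set (Finset W)) : Prop where
  affineIndependent : ∀ a ∈ T, AffineIndependent ℝ (fun p : a => (p : W))
  card_eq : ∀ a ∈ T, a.card = Module.finrank ℝ (vectorSpan ℝ Q) + 1
  vertices : ∀ a ∈ T, (a : Set W) ⊆ Set.extremePoints ℝ Q
  union_eq : ⋃ a ∈ T, convexHull ℝ (a : Set W) = Q
  inter_eq : ∀ a ∈ T, ∀ b ∈ T, ∃ f : Finset W, f ⊆ a ∧ f ⊆ b ∧
    convexHull ℝ (a : Set W) ∩ convexHull ℝ (b : Set W) = convexHull ℝ (f : Set W)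

/-- The list `L` enumerates without repetition the set `T` of maximal simplices (given by their
vertex sets) of a pure simplicial complex, in such a way that every simplex but the first meets the
union of the preceding ones in the union of a positive number of its codimension one faces. -/
structure IsShellingOrder (T : Set (Finset W)) (L : List (Finset W)) : Prop where
  nodup : L.Nodup
  mem_iff : ∀ a, a ∈ L ↔ a ∈ T
  inter_eq : ∀ (i : ℕ) (hi : i < L.length), 0 < i →
    ∃ F : Finset (Finset W), F.Nonempty ∧ (∀ f ∈ F, f ⊆ L[i] ∧ f.card + 1 = L[i].card) ∧
      convexHull ℝ (L[i] : Set W) ∩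
          (⋃ (j : ℕ) (hj : j < i), convexHull ℝ (L[j]'(hj.trans hi) : Set W)) =
        ⋃ f ∈ F, convexHull ℝ (f : Set W)

/-- The maximal simplices `T` admit a shelling order. -/
def IsShellable (T : Set (Finset W)) : Prop := ∃ L, IsShellingOrder T L

end Polytope

/-! ## Plane bipartite graphs -/

/-- A bipartite graph with colour classes `E`, `V` and edge set `C` (parallel edges are allowed),
with a rotation system, i.e. embedded into an oriented surface: `rotE c` and `rotV c` are the edges
that follow the edge `c` in the counterclockwise order around its end in `E`, respectively around
its end in `V`. -/
structure BipartiteMap (E V C : Type*) where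
  /-- The end of an edge in `E`. -/
  endE : C → E
  /-- The end of an edge in `V`. -/
  endV : C → V
  rotE : Equiv.Perm C
  rotV : Equiv.Perm C
  sameCycle_rotE : ∀ c d, rotE.SameCycle c d ↔ endE c = endE d
  sameCycle_rotV : ∀ c d, rotV.SameCycle c d ↔ endV c = endV d

namespace BipartiteMap

variable {E V C : Type*} (G : BipartiteMap E V C)

/-- The regions of `G`, which are the vertices of the dual graph. Draw the edge `c` horizontally
with its end in `V` on the left and its end in `E` on the right. If the region `r` is above `c`, then
at the left end of `c` it is bounded by `G.rotV c`, and it is below that edge; at the right end of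
the latter, it is bounded by `G.rotE (G.rotV c)`, and it is above that edge. So `r` is identified with
the set of the edges that it is above of, which is a cycle of `G.rotE * G.rotV`. -/
def Region : Type _ := Quotient (Equiv.Perm.SameCycle.setoid (G.rotE * G.rotV))

/-- The dual edge of `c` crosses `c` with `V` on its left and `E` on its right. Its endpoint is the
region above `c`, when `c` is drawn as in the definition of `Region`. -/
def head (c : C) : G.Region := Quotient.mk _ c

/-- The startpoint of the dual edge of `c`, i.e. the region below `c`. At the right end of `c`,
this region is bounded by `G.rotE c`, and it is above that edge. -/
def tail (c : C) : G.Region := G.head (G.rotE c)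

/-- `G` is a connected graph on the sphere. -/
structure IsConnectedPlane [Fintype E] [Fintype V] [Fintype C] : Prop where
  connected : ∀ x y : E ⊕ V,
    JoinedBy (fun c => Sum.inl (G.endE c)) (fun c => Sum.inr (G.endV c)) Finset.univ x y
  euler : Fintype.card E + Fintype.card V + Nat.card G.Region = Fintype.card C + 2

/-! ### The root polytope -/

section RootPolytope

variable [DecidableEq E] [DecidableEq V]

/-- The point `𝐞 + 𝐯` of `ℝ^E ⊕ ℝ^V` for the edge `c = ev`. -/
def edgePoint (c : C) : E ⊕ V → ℝ :=
  Pi.single (Sum.inl (G.endE c)) 1 + Pi.single (Sum.inr (G.endV c)) 1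

/-- The root polytope of `G`. -/
def rootPolytope : Set (E ⊕ V → ℝ) := convexHull ℝ (Set.range G.edgePoint)

variable [Fintype E] [Fintype V] [Fintype C] [DecidableEq C]

/-- The vertex set of the simplex that corresponds to the dual subgraph of the set `A` of dual edges,
i.e. to the set of the edges of `G` that are not crossed by elements of `A`. -/
noncomputable def dualSimplex (A : Finset C) : Finset (E ⊕ V → ℝ) := Aᶜ.image G.edgePoint

/-- The simplices that correspond to the duals of the spanning arborescences of the dual graph
rooted at `r₀`. -/
def arborescenceSimplices (r₀ : G.Region) : Set (Finset (E ⊕ V → ℝ)) :=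
  {a | ∃ A : Finset C, IsSpanningArborescence G.tail G.head r₀ A ∧ G.dualSimplex A = a}

end RootPolytope

/-! ### The tree of arborescences

Half-edges of the dual graph are pairs `(c, b)`, where `b = true` stands for the half of the dual edge
of `c` at its startpoint `G.tail c` and `b = false` for the half at its endpoint `G.head c`. -/

/-- The half-edge that follows the given one in the counterclockwise order around their common
vertex of the dual graph. -/
def rotDual : C × Bool → C × Bool
  | (c, true) => (G.rotV.symm c, false)
  | (c, false) => (G.rotE.symm c, true)

variable [DecidableEq C]

/-- One step of the counterclockwise tour of the boundary `∂N_A` of the regular neighbourhood of the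
root component of `A`, which is recorded by the half-edges that are encountered. A half-edge that
does not belong to `A` is crossed, after which the tour keeps turning around the same vertex. If the
half-edge belongs to `A`, then the tour follows that edge to its other end and keeps turning there. -/
def tourStep (A : Finset C) (x : C × Bool) : C × Bool :=
  if x.1 ∈ A then G.rotDual (x.1, !x.2) else G.rotDual x

/-- The edge at the `i`-th half-edge of the tour of `∂N_A` from the end of the dual edge of `κ`. -/
def tourEdge (κ : C) (A : Finset C) (i : ℕ) : C := ((G.tourStep A)^[i] (κ, false)).1

/-- The dual edge `δ` is not skipped, and it can be added to the arborescence `A`. -/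
def IsAdmissible (r₀ : G.Region) (A S : Finset C) (δ : C) : Prop :=
  δ ∉ A ∧ δ ∉ S ∧ IsArborescence G.tail G.head r₀ (insert δ A)

open Classical in
/-- The augmenting edge of `(A, S)`: the first admissible edge along the tour of `∂N_A`, if any. -/
noncomputable def augmentingEdge (r₀ : G.Region) (κ : C) (A S : Finset C) : Option C :=
  if h : ∃ i, G.IsAdmissible r₀ A S (G.tourEdge κ A i) then some (G.tourEdge κ A (Nat.find h))
  else none

theorem isAdmissible_of_augmentingEdge {r₀ : G.Region} {κ : C} {A S : Finset C} {δ : C}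
    (hδ : G.augmentingEdge r₀ κ A S = some δ) : G.IsAdmissible r₀ A S δ := by
  classical
  unfold augmentingEdge at hδ
  split_ifs at hδ with h
  have h1 := Nat.find_spec h
  rw [Option.some.injEq] at hδ
  rw [← hδ]
  exact h1

end BipartiteMap

/-- Rooted binary trees with labels, in which every node has either no descendant or a left and a
right one. -/
inductive LabelledBinaryTree (α : Type*) where
  | leaf (a : α) : LabelledBinaryTree α
  | node (a : α) (left right : LabelledBinaryTree α) : LabelledBinaryTree α

/-- The labels of the leaves of a binary tree, from right to left. -/
def LabelledBinaryTree.leavesRightToLeft {α : Type*} : LabelledBinaryTree α → List α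
  | .leaf a => [a]
  | .node _ left right => right.leavesRightToLeft ++ left.leavesRightToLeft

namespace BipartiteMap

variable {E V C : Type*}

/-- The part of the tree of arborescences that starts at the node `(A, S)`. -/
noncomputable def arborescenceTreeFrom [Fintype C] [DecidableEq C] (G : BipartiteMap E V C)
    (r₀ : G.Region) (κ : C) (A S : Finset C) :
    LabelledBinaryTree (Finset C × Finset C) :=
  match h : G.augmentingEdge r₀ κ A S with
  | none => .leaf (A, S)
  | some δ => .node (A, S) (arborescenceTreeFrom G r₀ κ A (insert δ S))
      (arborescenceTreeFrom G r₀ κ (insert δ A) S)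
termination_by Aᶜ.card + Sᶜ.card
decreasing_by
  · have hS := (G.isAdmissible_of_augmentingEdge h).2.1
    have := Finset.card_lt_card (Finset.compl_ssubset_compl.2 (Finset.ssubset_insert hS))
    omega
  · have hA := (G.isAdmissible_of_augmentingEdge h).1
    have := Finset.card_lt_card (Finset.compl_ssubset_compl.2 (Finset.ssubset_insert hA))
    omega

/-- The tree of arborescences, with nodes labelled by (arborescence, set of skipped edges). -/
noncomputable def arborescenceTree [Fintype C] [DecidableEq C] (G : BipartiteMap E V C)
    (r₀ : G.Region) (κ : C) :
    LabelledBinaryTree (Finset C × Finset C) :=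
  G.arborescenceTreeFrom r₀ κ ∅ ∅

open Classical in
/-- The spanning arborescences at the type I leaves of the tree of arborescences, i.e. at the leaves
whose arborescence is spanning, from right to left. -/
noncomputable def arborescencesRightToLeft [Fintype C] [DecidableEq C] (G : BipartiteMap E V C)
    (r₀ : G.Region) (κ : C) : List (Finset C) :=
  ((G.arborescenceTree r₀ κ).leavesRightToLeft.map Prod.fst).filter
    fun A => decide (IsSpanningArborescence G.tail G.head r₀ A)

end BipartiteMap

/-! Read the coefficients $w$ of a combination $\sum_c w_c(\mathbf e+\mathbf v)$ as lengths of the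
dual edges. The linear relations among the points $\mathbf e+\mathbf v$ are exactly the coboundaries
of functions on the regions (`ker_edgeCombination`, by Euler's formula), and these have coefficient
sum $0$. So two coefficient vectors of the same point differ by a potential.

Triangulation. Given $w \ge 0$, subtracting the distance from $r_0$ makes the lengths vanish along a
spanning arborescence and keeps them nonnegative (`exists_tight`), so the simplices cover $Q_G$. If
$w, w' \ge 0$ represent the same point and vanish on spanning arborescences $A$ and $B$, their
potential has both its minimum and its maximum at $r_0$, hence is constant and $w = w'$
(`coefficients_unique`). Thus $\sigma_A \cap \sigma_B$ is the face with vertices the points of the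
edges outside $A \cup B$.

Shelling. At a node with augmenting edge $\delta$, arborescences on the right contain $\delta$,
those on the left do not. If $B$ is on the left, exchanging the edge of $B$ with the same head for
$\delta$ gives some $B'$ on the right with $B' \setminus B = \{\delta\}$ (`exchange`). For every $D$
on the right, $\sigma_B \cap \sigma_D$ then lies in the facet of $\sigma_B$ opposite to $\delta$,
and this facet lies in $\sigma_{B'}$. Of the tour, the argument needs only that it meets every
half-edge at the root component (`TourCovers`), so that a leaf occurs only where no augmentation is
possible. -/

section Multigraph

/-! ### Arborescences in directed multigraphs: in-degrees, exchange, augmentation. -/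

variable {X C : Type*} {s t : C → X} {r : X} {A B : Finset C}

theorem JoinedBy.iff_of_closed {P : X → Prop} (hP : ∀ c ∈ A, P (s c) ↔ P (t c)) {x y : X}
    (h : JoinedBy s t A x y) : P x ↔ P y := by
  induction h with
  | refl => rfl
  | tail _ h ih =>
    obtain ⟨c, hc, ⟨rfl, rfl⟩ | ⟨rfl, rfl⟩⟩ := h
    · exact ih.trans (hP c hc)
    · exact ih.trans (hP c hc).symm

theorem JoinedBy.step {c : C} (hc : c ∈ A) : JoinedBy s t A (s c) (t c) :=
  Relation.ReflTransGen.single ⟨c, hc, Or.inl ⟨rfl, rfl⟩⟩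

theorem JoinedBy.trans {x y z : X} (h : JoinedBy s t A x y) (h' : JoinedBy s t A y z) :
    JoinedBy s t A x z := Relation.ReflTransGen.trans h h'

theorem JoinedBy.symm {x y : X} (h : JoinedBy s t A x y) : JoinedBy s t A y x := by
  refine (JoinedBy.iff_of_closed (P := fun z => JoinedBy s t A z x) ?_ h).1
    Relation.ReflTransGen.refl
  intro c hc
  refine ⟨fun h => .trans (.single ⟨c, hc, Or.inr ⟨rfl, rfl⟩⟩) h, (JoinedBy.step hc).trans⟩

theorem joinedBy_iff_of_mem {c : C} (hc : c ∈ A) :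
    JoinedBy s t A r (s c) ↔ JoinedBy s t A r (t c) :=
  ⟨fun h => h.trans (.step hc), fun h => h.trans (JoinedBy.step hc).symm⟩

theorem JoinedBy.mono (hAB : A ⊆ B) {x y : X} (h : JoinedBy s t A x y) : JoinedBy s t B x y :=
  Relation.ReflTransGen.mono (fun _ _ ⟨c, hc, h⟩ => ⟨c, hAB hc, h⟩) _ _ h

theorem ReachableBy.mono (hAB : A ⊆ B) {x y : X} (h : ReachableBy s t A x y) :
    ReachableBy s t B x y :=
  Relation.ReflTransGen.mono (fun _ _ ⟨c, hc, h⟩ => ⟨c, hAB hc, h⟩) _ _ h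

theorem ReachableBy.of_closed {P : X → Prop} (hP : ∀ c ∈ A, P (s c) → P (t c)) {x y : X}
    (h : ReachableBy s t A x y) (hx : P x) : P y := by
  induction h with
  | refl => exact hx
  | tail _ h ih =>
    obtain ⟨c, hc, rfl, rfl⟩ := h
    exact hP c hc ih

theorem ReachableBy.step {x : X} {c : C} (h : ReachableBy s t A x (s c)) (hc : c ∈ A) :
    ReachableBy s t A x (t c) :=
  Relation.ReflTransGen.tail h ⟨c, hc, rfl, rfl⟩

theorem ReachableBy.joinedBy {x y : X} (h : ReachableBy s t A x y) : JoinedBy s t A x y :=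
  Relation.ReflTransGen.mono (fun _ _ ⟨c, hc, h⟩ => ⟨c, hc, Or.inl h⟩) _ _ h

variable [DecidableEq C]

/-- A directed path from `r` can leave the root component of `A` only through `δ`, so `s δ` must lie
in it; then acyclicity keeps `t δ` out. -/
theorem IsArborescence.joinedBy_of_insert {δ : C} (h : IsArborescence s t r (insert δ A))
    (hδ : δ ∉ A) : JoinedBy s t A r (s δ) ∧ ¬ JoinedBy s t A r (t δ) := by
  have h1 := h.acyclic δ (Finset.mem_insert_self _ _)
  rw [Finset.erase_insert hδ] at h1
  have h2 : JoinedBy s t A r (s δ) := by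
    by_contra hn
    refine hn ((h.reachable _ (h.edge_mem δ (Finset.mem_insert_self _ _))).of_closed
      (P := JoinedBy s t A r) ?_ Relation.ReflTransGen.refl)
    intro c hc hs
    rcases Finset.mem_insert.1 hc with rfl | hc
    · exact (hn hs).elim
    · exact (joinedBy_iff_of_mem hc).1 hs
  exact ⟨h2, fun h3 => h1 (h2.symm.trans h3)⟩

theorem IsArborescence.joinedBy_erase {c : C} (h : IsArborescence s t r A) (hc : c ∈ A) :
    JoinedBy s t (A.erase c) r (s c) ∧ ¬ JoinedBy s t (A.erase c) r (t c) := by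
  rw [← Finset.insert_erase hc] at h
  exact h.joinedBy_of_insert (Finset.notMem_erase _ _)

theorem IsArborescence.head_ne_root (h : IsArborescence s t r A) {c : C} (hc : c ∈ A) :
    t c ≠ r := fun he => (h.joinedBy_erase hc).2 (he ▸ Relation.ReflTransGen.refl)

/-- Suppose `a` and `b` share a head. Whichever of them a directed path from `r` used first would
join that head to `r` without the other one. -/
theorem IsArborescence.head_injOn (h : IsArborescence s t r A) : Set.InjOn t (A : Set C) := by
  intro a ha b hb hab
  by_contra hne
  have hPa := (h.joinedBy_erase ha).2
  have hPb := (h.joinedBy_erase hb).2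
  have hr := h.reachable _ ((h.edge_mem a ha).trans (.step ha))
  refine hPa (hr.of_closed
    (P := fun x => JoinedBy s t (A.erase a) r x ∧ JoinedBy s t (A.erase b) r x) ?_
    ⟨Relation.ReflTransGen.refl, Relation.ReflTransGen.refl⟩).1
  rintro c hc ⟨h1, h2⟩
  by_cases hca : c = a
  · subst hca
    exact (hPb (hab ▸ h2.trans (.step (Finset.mem_erase.2 ⟨hne, ha⟩)))).elim
  by_cases hcb : c = b
  · subst hcb
    exact (hPa (hab ▸ h1.trans (.step (Finset.mem_erase.2 ⟨hca, hb⟩)))).elim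
  exact ⟨h1.trans (.step (Finset.mem_erase.2 ⟨hca, hc⟩)),
    h2.trans (.step (Finset.mem_erase.2 ⟨hcb, hc⟩))⟩

theorem IsSpanningArborescence.reachableBy (h : IsSpanningArborescence s t r A) (x : X) :
    ReachableBy s t A r x := h.reachable x (h.spanning x)

/-- In-degree criterion. For acyclicity, let `P` be the set reachable without `c`. It contains `s c`
but not `t c`, and since each vertex has only one entering edge, the other edges cannot enter `P`
from outside either; so `P` separates the ends of `c`. -/
theorem IsSpanningArborescence.of_head_injOn (hr : ∀ x, ReachableBy s t A r x)
    (hne : ∀ c ∈ A, t c ≠ r) (hinj : Set.InjOn t (A : Set C)) :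
    IsSpanningArborescence s t r A where
  edge_mem c _ := (hr _).joinedBy
  reachable x _ := hr x
  spanning x := (hr x).joinedBy
  acyclic c hc hj := by
    set P : X → Prop := ReachableBy s t (A.erase c) r
    have hPt : ¬ P (t c) := by
      intro h
      rcases Relation.ReflTransGen.cases_tail h with h | ⟨_, _, b, hb, _, hb'⟩
      · exact hne c hc h
      · exact (Finset.mem_erase.1 hb).1 (hinj (Finset.mem_of_mem_erase hb) hc hb')
    have hPs : P (s c) := by
      by_contra hn
      refine hPt ((hr (t c)).of_closed (P := P) ?_ Relation.ReflTransGen.refl)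
      intro b hb h
      by_cases hbc : b = c
      · exact (hn (hbc ▸ h)).elim
      · exact h.step (Finset.mem_erase.2 ⟨hbc, hb⟩)
    refine hPt ((hj.iff_of_closed (P := P) ?_).1 hPs)
    intro b hb
    refine ⟨fun h => h.step hb, fun h => ?_⟩
    rcases Relation.ReflTransGen.cases_tail h with h | ⟨_, h, b', hb', rfl, hbb⟩
    · exact (hne b (Finset.mem_of_mem_erase hb) h).elim
    · rwa [← hinj (Finset.mem_of_mem_erase hb') (Finset.mem_of_mem_erase hb) hbb]

/-- If all vertices are reachable from `r` by `F`, then `F` contains a spanning arborescence. -/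
theorem exists_isSpanningArborescence_subset {F : Finset C} (hF : ∀ x, ReachableBy s t F r x) :
    ∃ A ⊆ F, IsSpanningArborescence s t r A := by
  classical
  induction F using Finset.strongInduction with
  | H F ih =>
    by_cases hmin : ∃ c ∈ F, ∀ x, ReachableBy s t (F.erase c) r x
    · obtain ⟨c, hc, h⟩ := hmin
      obtain ⟨A, hA, hA'⟩ := ih _ (Finset.erase_ssubset hc) h
      exact ⟨A, hA.trans (Finset.erase_subset _ _), hA'⟩
    push Not at hmin
    -- `F` is now minimal: an edge whose head is reachable without it would be superfluous.
    have key : ∀ c ∈ F, ¬ ReachableBy s t (F.erase c) r (t c) := by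
      intro c hc h
      obtain ⟨x, hx⟩ := hmin c hc
      refine hx ((hF x).of_closed (P := ReachableBy s t (F.erase c) r) ?_
        Relation.ReflTransGen.refl)
      intro b hb h'
      by_cases hbc : b = c
      · exact hbc ▸ h
      · exact h'.step (Finset.mem_erase.2 ⟨hbc, hb⟩)
    refine ⟨F, subset_rfl, .of_head_injOn hF
      (fun c hc h => key c hc (h ▸ Relation.ReflTransGen.refl)) ?_⟩
    intro a ha b hb hab
    by_contra hne
    refine key a ha ((hF (t a)).of_closed
      (P := fun x => ReachableBy s t (F.erase a) r x ∧ ReachableBy s t (F.erase b) r x) ?_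
      ⟨Relation.ReflTransGen.refl, Relation.ReflTransGen.refl⟩).1
    rintro c hc ⟨h1, h2⟩
    by_cases hca : c = a
    · subst hca
      exact (key b hb (hab ▸ h2.step (Finset.mem_erase.2 ⟨hne, ha⟩))).elim
    by_cases hcb : c = b
    · subst hcb
      exact (key a ha (hab ▸ h1.step (Finset.mem_erase.2 ⟨hca, hb⟩))).elim
    exact ⟨h1.step (Finset.mem_erase.2 ⟨hca, hc⟩), h2.step (Finset.mem_erase.2 ⟨hcb, hc⟩)⟩

/-- The edge `δ`, by which an arborescence `A₀ ⊆ A` can be augmented, may replace the edge of the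
spanning arborescence `A` with the same head. -/
theorem IsSpanningArborescence.exchange {A₀ : Finset C} {δ : C}
    (hA : IsSpanningArborescence s t r A) (h₀ : A₀ ⊆ A) (hδ : δ ∉ A)
    (hδ₀ : IsArborescence s t r (insert δ A₀)) :
    ∃ a ∈ A, a ∉ A₀ ∧ IsSpanningArborescence s t r (insert δ (A.erase a)) := by
  obtain ⟨hs, ht⟩ := hδ₀.joinedBy_of_insert fun h => hδ (h₀ h)
  have htr : t δ ≠ r := fun h => ht (h ▸ Relation.ReflTransGen.refl)
  obtain ⟨a, ha, hat⟩ : ∃ a ∈ A, t a = t δ := by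
    rcases Relation.ReflTransGen.cases_tail (hA.reachableBy (t δ)) with h | ⟨_, _, a, ha, _, h⟩
    · exact (htr h).elim
    · exact ⟨a, ha, h⟩
  have hsub : ∀ c ∈ insert δ A₀, t c = t δ → c = δ := fun c hc h =>
    hδ₀.head_injOn hc (Finset.mem_insert_self _ _) h
  have ha₀ : a ∉ A₀ := fun h => hδ (hsub a (Finset.mem_insert_of_mem h) hat ▸ ha)
  refine ⟨a, ha, ha₀, .of_head_injOn ?_ ?_ ?_⟩
  · have hsδ : ReachableBy s t (insert δ (A.erase a)) r (s δ) := by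
      -- A path that uses `δ` leaves the root component of `A₀` and cannot come back, so a path to
      -- `s δ` avoids `δ`. It then lies in `A₀` and survives the removal of `a`.
      have h1 : ReachableBy s t A₀ r (s δ) := by
        refine ((hδ₀.reachable _ (hs.mono (Finset.subset_insert _ _))).of_closed
          (P := fun x => ReachableBy s t A₀ r x ∨ ¬ JoinedBy s t A₀ r x) ?_
          (Or.inl Relation.ReflTransGen.refl)).resolve_right (not_not.2 hs)
        intro c hc h
        rcases Finset.mem_insert.1 hc with rfl | hc
        · exact Or.inr ht
        · exact h.imp (fun h => h.step hc) (fun h h' => h ((joinedBy_iff_of_mem hc).2 h'))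
      refine h1.mono fun c hc => Finset.mem_insert_of_mem (Finset.mem_erase.2 ⟨?_, h₀ hc⟩)
      rintro rfl
      exact ha₀ hc
    intro x
    refine (hA.reachableBy x).of_closed (P := ReachableBy s t (insert δ (A.erase a)) r) ?_
      Relation.ReflTransGen.refl
    intro c hc h
    by_cases hca : c = a
    · rw [hca, hat]
      exact hsδ.step (Finset.mem_insert_self _ _)
    · exact h.step (Finset.mem_insert_of_mem (Finset.mem_erase.2 ⟨hca, hc⟩))
  · intro c hc
    rcases Finset.mem_insert.1 hc with rfl | hc
    · exact htr
    · exact hA.head_ne_root (Finset.mem_of_mem_erase hc)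
  · have key : ∀ c ∈ A.erase a, t c ≠ t δ := fun c hc h =>
      (Finset.mem_erase.1 hc).1 (hA.head_injOn (Finset.mem_of_mem_erase hc) ha (h.trans hat.symm))
    intro c hc d hd hcd
    rw [Finset.mem_coe] at hc hd
    rcases Finset.mem_insert.1 hc with hc' | hc' <;> rcases Finset.mem_insert.1 hd with hd' | hd'
    · exact hc'.trans hd'.symm
    · exact (key d hd' (hc' ▸ hcd.symm)).elim
    · exact (key c hc' (hd' ▸ hcd)).elim
    · exact hA.head_injOn (Finset.mem_of_mem_erase hc') (Finset.mem_of_mem_erase hd') hcd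

/-- An arborescence that is a proper subset of a spanning arborescence can be augmented. -/
theorem IsSpanningArborescence.exists_augmenting (hB : IsSpanningArborescence s t r B)
    (hA : IsArborescence s t r A) (hAB : A ⊂ B) :
    ∃ δ ∈ B, δ ∉ A ∧ JoinedBy s t A r (s δ) ∧ IsArborescence s t r (insert δ A) := by
  obtain ⟨b, hb, hbA⟩ := Finset.exists_of_ssubset hAB
  have hnb : ¬ JoinedBy s t A r (t b) := fun h => (hB.joinedBy_erase hb).2 <| h.mono fun c hc =>
    Finset.mem_erase.2 ⟨ne_of_mem_of_not_mem hc hbA, hAB.1 hc⟩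
  obtain ⟨δ, hδ, hs, ht⟩ : ∃ δ ∈ B, JoinedBy s t A r (s δ) ∧ ¬ JoinedBy s t A r (t δ) := by
    by_contra! h
    exact hnb ((hB.reachableBy (t b)).of_closed h Relation.ReflTransGen.refl)
  have hsub : insert δ A ⊆ B := Finset.insert_subset hδ hAB.1
  have hδA : δ ∉ A := fun h => ht ((joinedBy_iff_of_mem h).1 hs)
  have hmono := Finset.subset_insert δ A
  refine ⟨δ, hδ, hδA, hs, ?_, fun c hc h => hB.acyclic c (hsub hc)
    (h.mono (Finset.erase_subset_erase c hsub)), fun x hx => ?_⟩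
  · intro c hc
    rcases Finset.mem_insert.1 hc with rfl | hc
    · exact hs.mono hmono
    · exact (hA.edge_mem c hc).mono hmono
  · have hsr := (hA.reachable _ hs).mono hmono
    refine ((hx.iff_of_closed (P := ReachableBy s t (insert δ A) r) ?_).1 Relation.ReflTransGen.refl)
    intro c hc
    refine ⟨fun h => h.step hc, fun h => ?_⟩
    rcases Finset.mem_insert.1 hc with rfl | hc
    · exact hsr
    · exact (hA.reachable _ (hA.edge_mem c hc)).mono hmono

end Multigraph

/-- Exchanging the values of a map at two points merges the orbits of these points. -/
theorem exists_iterate_of_exchange {α : Type*} {f g : α → α} {a b x₀ : α} {K : α → Prop}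
    (hK : ∀ x, K (f x) ↔ K x) (hx₀ : K x₀) (ha : K a) (hb : ¬ K b)
    (hga : g a = f b) (hgb : g b = f a) (hg : ∀ x, x ≠ a → x ≠ b → g x = f x)
    (hax : ∃ n, f^[n] x₀ = a) (hbb : ∃ n, f^[n] (f b) = b) :
    (∀ n, ∃ i, g^[i] x₀ = f^[n] x₀) ∧ ∀ n, ∃ i, g^[i] x₀ = f^[n] b := by
  have hKn : ∀ n x, K (f^[n] x) ↔ K x := by
    intro n x
    induction n with
    | zero => rfl
    | succ n ih => rw [Function.iterate_succ_apply', hK, ih]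
  set O : α → Prop := fun y => ∃ i, g^[i] x₀ = y with hO
  have hOg : ∀ y, O y → O (g y) := by
    rintro _ ⟨i, rfl⟩
    exact ⟨i + 1, Function.iterate_succ_apply' _ _ _⟩
  have hO0 : O x₀ := ⟨0, rfl⟩
  -- Up to `a`, the orbits of `x₀` under `f` and `g` agree. At `a`, `g` jumps to `f b` and runs
  -- through the `f`-cycle of `b`, which returns to `b`.
  have hOa : O a := by
    by_contra hn
    obtain ⟨n, rfl⟩ := hax
    have : ∀ m, O (f^[m] x₀) := by
      intro m
      induction m with
      | zero => exact hO0
      | succ m ih =>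
        rw [Function.iterate_succ_apply', ← hg]
        · exact hOg _ ih
        · exact fun h => hn (h ▸ ih)
        · exact fun h => hb (h ▸ (hKn m x₀).2 hx₀)
    exact hn (this n)
  have hOb : O b := by
    by_contra hn
    obtain ⟨n, hn'⟩ := hbb
    have : ∀ m, O (f^[m] (f b)) := by
      intro m
      induction m with
      | zero => exact hga ▸ hOg _ hOa
      | succ m ih =>
        rw [Function.iterate_succ_apply', ← hg]
        · exact hOg _ ih
        · exact fun h => hb ((hK b).1 ((hKn m (f b)).1 (h ▸ ha)))
        · exact fun h => hn (h ▸ ih)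
    exact hn (hn' ▸ this n)
  have hOf : ∀ y, O y → O (f y) := by
    intro y hy
    by_cases hya : y = a
    · rw [hya, ← hgb]
      exact hOg _ hOb
    by_cases hyb : y = b
    · rw [hyb, ← hga]
      exact hOg _ hOa
    · rw [← hg y hya hyb]
      exact hOg _ hy
  have hOn : ∀ y, O y → ∀ n, O (f^[n] y) := by
    intro y hy n
    induction n with
    | zero => exact hy
    | succ n ih => rw [Function.iterate_succ_apply']; exact hOf _ ih
  exact ⟨hOn _ hO0, hOn _ hOb⟩

/-! ### The tour around the root component. -/

namespace BipartiteMap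

variable {E V C : Type*} (G : BipartiteMap E V C)

theorem head_eq_head_iff {c d : C} :
    G.head c = G.head d ↔ (G.rotE * G.rotV).SameCycle c d := Quotient.eq

theorem tail_eq_head_rotV_symm (c : C) : G.tail c = G.head (G.rotV.symm c) :=
  (G.head_eq_head_iff.2 ⟨1, by simp⟩).symm

/-- The region at a half-edge of the dual graph. -/
def base : C × Bool → G.Region
  | (c, true) => G.tail c
  | (c, false) => G.head c

theorem base_rotDual (x : C × Bool) : G.base (G.rotDual x) = G.base x := by
  obtain ⟨c, _ | _⟩ := x
  · simp [rotDual, base, tail]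
  · simp [rotDual, base, tail_eq_head_rotV_symm]

theorem exists_iterate_rotDual [Finite C] {x y : C × Bool} (h : G.base x = G.base y) :
    ∃ n, G.rotDual^[n] x = y := by
  have key : ∀ c d, G.head c = G.head d → ∃ n, G.rotDual^[n] (c, false) = (d, false) := by
    intro c d hcd
    obtain ⟨n, -, hn⟩ := (Equiv.Perm.sameCycle_inv.2 (G.head_eq_head_iff.1 hcd)).exists_pow_eq'
    -- Two turns take an incoming half-edge to the next incoming one, which is one step of the
    -- inverse of `rotE * rotV`.
    refine ⟨2 * n, ?_⟩
    rw [← hn, Function.iterate_mul]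
    clear hn
    induction n with
    | zero => rfl
    | succ n ih => rw [Function.iterate_succ_apply', ih, pow_succ']; rfl
  have key' : ∀ c y, G.head c = G.base y → ∃ n, G.rotDual^[n] (c, false) = y := by
    rintro c ⟨d, _ | _⟩ h
    · exact key c d h
    · obtain ⟨n, hn⟩ := key c (G.rotE d) h
      refine ⟨n + 1, ?_⟩
      rw [Function.iterate_succ_apply', hn]
      simp [rotDual]
  obtain ⟨c, _ | _⟩ := x
  · exact key' c y h
  · obtain ⟨n, hn⟩ := key' _ y ((G.base_rotDual (c, true)).trans h)
    exact ⟨n + 1, by rw [Function.iterate_succ_apply]; exact hn⟩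

variable [DecidableEq C]

/-- The tour of `∂N_A` meets every half-edge at a vertex of the root component of `A`. -/
def TourCovers (r₀ : G.Region) (κ : C) (A : Finset C) : Prop :=
  ∀ x, JoinedBy G.tail G.head A r₀ (G.base x) → ∃ i, (G.tourStep A)^[i] (κ, false) = x

variable {G} {r₀ : G.Region} {κ : C} {A S : Finset C}

theorem tourStep_of_mem {x : C × Bool} (h : x.1 ∈ A) :
    G.tourStep A x = G.rotDual (x.1, !x.2) := if_pos h

theorem tourStep_of_notMem {x : C × Bool} (h : x.1 ∉ A) : G.tourStep A x = G.rotDual x := if_neg h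

theorem tourCovers_empty [Finite C] (hκ : G.head κ = r₀) : G.TourCovers r₀ κ ∅ := by
  intro x hx
  have hx' : r₀ = G.base x := (hx.iff_of_closed (P := fun y => r₀ = y) (by simp)).1 rfl
  have hstep : G.tourStep ∅ = G.rotDual := funext fun x => tourStep_of_notMem (by simp)
  rw [hstep]
  exact G.exists_iterate_rotDual (hκ.trans hx')

theorem joinedBy_base_tourStep (x : C × Bool) :
    JoinedBy G.tail G.head A r₀ (G.base (G.tourStep A x)) ↔
      JoinedBy G.tail G.head A r₀ (G.base x) := by
  obtain ⟨c, b⟩ := x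
  by_cases h : c ∈ A
  · rw [tourStep_of_mem h, base_rotDual]
    cases b
    · exact joinedBy_iff_of_mem h
    · exact (joinedBy_iff_of_mem h).symm
  · rw [tourStep_of_notMem h, base_rotDual]

/-- Off the root component, `tourStep A` just turns around a region. Adding `δ` exchanges the
successors of its two halves, which splices the cycle around the new region `G.head δ` into the
tour. -/
theorem TourCovers.insert [Finite C] (hA : IsArborescence G.tail G.head r₀ A)
    (h : G.TourCovers r₀ κ A) (hκ : G.head κ = r₀) {δ : C} (hδ : δ ∉ A)
    (hδA : IsArborescence G.tail G.head r₀ (insert δ A)) : G.TourCovers r₀ κ (insert δ A) := by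
  obtain ⟨hs, ht⟩ := hδA.joinedBy_of_insert hδ
  have hK := joinedBy_base_tourStep (G := G) (r₀ := r₀) (A := A)
  have hout : ∀ x, ¬ JoinedBy G.tail G.head A r₀ (G.base x) → G.tourStep A x = G.rotDual x := by
    rintro ⟨c, b⟩ hx
    refine tourStep_of_notMem fun hc => hx ?_
    have := hA.edge_mem c hc
    cases b
    · exact (joinedBy_iff_of_mem hc).1 this
    · exact this
  have hiter : ∀ x, ¬ JoinedBy G.tail G.head A r₀ (G.base x) → ∀ n,
      (G.tourStep A)^[n] x = G.rotDual^[n] x ∧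
        ¬ JoinedBy G.tail G.head A r₀ (G.base ((G.tourStep A)^[n] x)) := by
    intro x hx n
    induction n with
    | zero => exact ⟨rfl, hx⟩
    | succ n ih =>
      rw [Function.iterate_succ_apply', Function.iterate_succ_apply', hK, ← ih.1]
      exact ⟨hout _ ih.2, ih.2⟩
  have horbit : ∀ x y, ¬ JoinedBy G.tail G.head A r₀ (G.base x) → G.base x = G.base y →
      ∃ n, (G.tourStep A)^[n] x = y := by
    intro x y hx hxy
    obtain ⟨n, hn⟩ := G.exists_iterate_rotDual hxy
    exact ⟨n, (hiter x hx n).1.trans hn⟩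
  have hb : ¬ JoinedBy G.tail G.head A r₀ (G.base (δ, false)) := ht
  have hmem : ∀ b : Bool, (δ, b).1 ∈ Insert.insert δ A := fun b => Finset.mem_insert_self _ _
  obtain ⟨h1, h2⟩ := exists_iterate_of_exchange (f := G.tourStep A)
    (g := G.tourStep (Insert.insert δ A)) (a := (δ, true)) (b := (δ, false)) (x₀ := (κ, false))
    (K := fun x => JoinedBy G.tail G.head A r₀ (G.base x)) hK
    (by rw [base, hκ]; exact Relation.ReflTransGen.refl) hs hb
    (by rw [tourStep_of_mem (hmem _), tourStep_of_notMem hδ]; rfl)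
    (by rw [tourStep_of_mem (hmem _), tourStep_of_notMem hδ]; rfl)
    (by
      rintro ⟨c, b⟩ hca hcb
      have hcδ : c ≠ δ := by
        rintro rfl
        cases b
        · exact hcb rfl
        · exact hca rfl
      simp [tourStep, hcδ])
    (h _ hs)
    (horbit _ _ ((hK _).not.2 hb) (by rw [hout _ hb, base_rotDual]))
  intro x hx
  by_cases hxA : JoinedBy G.tail G.head A r₀ (G.base x)
  · obtain ⟨n, rfl⟩ := h x hxA
    exact h1 n
  · have hx' : G.base x = G.head δ := by
      refine ((hx.iff_of_closed (P := fun y => JoinedBy G.tail G.head A r₀ y ∨ y = G.head δ)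
        ?_).1 (Or.inl Relation.ReflTransGen.refl)).resolve_left hxA
      intro c hc
      rcases Finset.mem_insert.1 hc with rfl | hc
      · exact ⟨fun _ => Or.inr rfl, fun _ => Or.inl hs⟩
      · have h1 := hA.edge_mem c hc
        exact ⟨fun _ => Or.inl ((joinedBy_iff_of_mem hc).1 h1), fun _ => Or.inl h1⟩
    obtain ⟨n, rfl⟩ := horbit (δ, false) x hb hx'.symm
    exact h2 n

theorem augmentingEdge_eq_none (h : G.augmentingEdge r₀ κ A S = none) (i : ℕ) :
    ¬ G.IsAdmissible r₀ A S (G.tourEdge κ A i) := by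
  classical
  unfold augmentingEdge at h
  split_ifs at h with h'
  exact fun hi => h' ⟨i, hi⟩

/-- Otherwise some edge of `B` augments `A`; its starting half is at the root component, so the tour
would have found it. -/
theorem eq_of_augmentingEdge_eq_none (hA : IsArborescence G.tail G.head r₀ A)
    (hT : G.TourCovers r₀ κ A) (h : G.augmentingEdge r₀ κ A S = none) {B : Finset C}
    (hB : IsSpanningArborescence G.tail G.head r₀ B) (hAB : A ⊆ B) (hBS : Disjoint B S) :
    A = B := by
  by_contra hne
  obtain ⟨δ, hδ, hδA, hs, hins⟩ := hB.exists_augmenting hA (hAB.ssubset_of_ne hne)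
  obtain ⟨i, hi⟩ := hT (δ, true) hs
  refine augmentingEdge_eq_none h i ?_
  rw [tourEdge, hi]
  exact ⟨hδA, Finset.disjoint_left.1 hBS hδ, hins⟩

/-! ### The leaves of the tree and their exchange property. -/

theorem arborescenceTreeFrom_of_none [Fintype C] (h : G.augmentingEdge r₀ κ A S = none) :
    G.arborescenceTreeFrom r₀ κ A S = .leaf (A, S) := by
  rw [arborescenceTreeFrom]
  split
  · rfl
  · simp_all

theorem arborescenceTreeFrom_of_some [Fintype C] {δ : C}
    (h : G.augmentingEdge r₀ κ A S = some δ) :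
    G.arborescenceTreeFrom r₀ κ A S = .node (A, S) (G.arborescenceTreeFrom r₀ κ A (insert δ S))
      (G.arborescenceTreeFrom r₀ κ (insert δ A) S) := by
  rw [arborescenceTreeFrom]
  split
  · simp_all
  · simp_all

/-- If `B` precedes `A` in the list, then so does some `B'` that has only one element outside `A`,
and that element belongs to `B`. -/
def IsExchangeOrder (L : List (Finset C)) : Prop :=
  ∀ (i : ℕ) (hi : i < L.length) (j : ℕ) (hj : j < i),
    ∃ (k : ℕ) (hk : k < i), ∃ δ ∈ L[j], L[k] \ L[i] = {δ}

theorem IsExchangeOrder.append {L L' : List (Finset C)} (hL : IsExchangeOrder L)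
    (hL' : IsExchangeOrder L')
    (h : ∀ A ∈ L', ∀ B ∈ L, ∃ B' ∈ L, ∃ δ ∈ B, B' \ A = {δ}) : IsExchangeOrder (L ++ L') := by
  intro i hi j hj
  by_cases hiL : i < L.length
  · obtain ⟨k, hk, δ, hδ, he⟩ := hL i hiL j hj
    refine ⟨k, hk, δ, ?_, ?_⟩
    · rwa [List.getElem_append_left (hj.trans hiL)]
    · rwa [List.getElem_append_left (hk.trans hiL), List.getElem_append_left hiL]
  · have hi' : i - L.length < L'.length := by rw [List.length_append] at hi; omega
    have hgi : (L ++ L')[i] = L'[i - L.length] := List.getElem_append_right (by omega)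
    by_cases hjL : j < L.length
    · obtain ⟨B', hB', δ, hδ, he⟩ := h _ (List.getElem_mem hi') _ (List.getElem_mem hjL)
      obtain ⟨k, hk, rfl⟩ := List.getElem_of_mem hB'
      refine ⟨k, by omega, δ, ?_, ?_⟩
      · rwa [List.getElem_append_left hjL]
      · rwa [List.getElem_append_left hk, hgi]
    · obtain ⟨k, hk, δ, hδ, he⟩ := hL' _ hi' (j - L.length) (by omega)
      refine ⟨k + L.length, by omega, δ, ?_, ?_⟩
      · rwa [List.getElem_append_right (by omega)]
      · rw [hgi, ← he, List.getElem_append_right (by omega)]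
        simp

open Classical in
/-- The spanning arborescences at the leaves below the node `(A, S)`, from right to left. -/
noncomputable def leavesFrom [Fintype C] (G : BipartiteMap E V C) (r₀ : G.Region) (κ : C)
    (A S : Finset C) : List (Finset C) :=
  ((G.arborescenceTreeFrom r₀ κ A S).leavesRightToLeft.map Prod.fst).filter
    fun A => decide (IsSpanningArborescence G.tail G.head r₀ A)

theorem leavesFrom_of_some [Fintype C] {δ : C} (h : G.augmentingEdge r₀ κ A S = some δ) :
    G.leavesFrom r₀ κ A S =
      G.leavesFrom r₀ κ (insert δ A) S ++ G.leavesFrom r₀ κ A (insert δ S) := by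
  simp [leavesFrom, arborescenceTreeFrom_of_some h, LabelledBinaryTree.leavesRightToLeft]

theorem leavesFrom_spec [Fintype C] (hκ : G.head κ = r₀) (n : ℕ) :
    ∀ A S : Finset C, Aᶜ.card + Sᶜ.card = n → IsArborescence G.tail G.head r₀ A →
      G.TourCovers r₀ κ A → Disjoint A S →
      (∀ B, B ∈ G.leavesFrom r₀ κ A S ↔
        IsSpanningArborescence G.tail G.head r₀ B ∧ A ⊆ B ∧ Disjoint B S) ∧
      (G.leavesFrom r₀ κ A S).Nodup ∧ IsExchangeOrder (G.leavesFrom r₀ κ A S) := by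
  induction n using Nat.strong_induction_on with
  | h n ih =>
  intro A S hn hA hT hAS
  cases haug : G.augmentingEdge r₀ κ A S with
  | none =>
    have hL : ∀ B, B ∈ G.leavesFrom r₀ κ A S ↔
        B = A ∧ IsSpanningArborescence G.tail G.head r₀ B := by
      intro B
      simp [leavesFrom, arborescenceTreeFrom_of_none haug, LabelledBinaryTree.leavesRightToLeft]
    have hlen : (G.leavesFrom r₀ κ A S).length ≤ 1 := by
      refine (List.length_filter_le _ _).trans ?_
      simp [arborescenceTreeFrom_of_none haug, LabelledBinaryTree.leavesRightToLeft]
    refine ⟨fun B => ?_, ?_, ?_⟩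
    · rw [hL]
      refine ⟨?_, fun ⟨h1, h2, h3⟩ =>
        ⟨(eq_of_augmentingEdge_eq_none hA hT haug h1 h2 h3).symm, h1⟩⟩
      rintro ⟨rfl, h⟩
      exact ⟨h, subset_rfl, hAS⟩
    · refine List.Nodup.filter _ ?_
      simp [arborescenceTreeFrom_of_none haug, LabelledBinaryTree.leavesRightToLeft]
    · intro i hi j hj
      omega
  | some δ =>
    obtain ⟨hδA, hδS, hδ⟩ := G.isAdmissible_of_augmentingEdge haug
    have hcS := Finset.card_lt_card (Finset.compl_ssubset_compl.2 (Finset.ssubset_insert hδS))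
    have hcA := Finset.card_lt_card (Finset.compl_ssubset_compl.2 (Finset.ssubset_insert hδA))
    obtain ⟨hR, hRn, hRe⟩ := ih _ (by omega) (insert δ A) S rfl hδ (hT.insert hA hκ hδA hδ)
      (Finset.disjoint_insert_left.2 ⟨hδS, hAS⟩)
    obtain ⟨hL, hLn, hLe⟩ := ih _ (by omega) A (insert δ S) rfl hA hT
      (Finset.disjoint_insert_right.2 ⟨hδA, hAS⟩)
    rw [leavesFrom_of_some haug]
    refine ⟨fun B => ?_, List.nodup_append.2 ⟨hRn, hLn, ?_⟩, hRe.append hLe ?_⟩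
    · rw [List.mem_append, hR, hL, Finset.insert_subset_iff, Finset.disjoint_insert_right]
      tauto
    · rintro B hB _ hB' rfl
      exact (Finset.disjoint_insert_right.1 ((hL B).1 hB').2.2).1
        (((hR B).1 hB).2.1 (Finset.mem_insert_self _ _))
    -- Exchanging into `B` the edge `δ`, common to all arborescences on the right, moves `B` there:
    -- the removed edge is outside `A`, and `δ` is not skipped.
    · intro B hB D hD
      obtain ⟨hB, hAB, hBS⟩ := (hL B).1 hB
      rw [Finset.disjoint_insert_right] at hBS
      obtain ⟨a, ha, haA, hex⟩ := hB.exchange hAB hBS.1 hδ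
      refine ⟨insert δ (B.erase a), (hR _).2 ⟨hex, ?_, ?_⟩, δ,
        ((hR D).1 hD).2.1 (Finset.mem_insert_self _ _), ?_⟩
      · refine Finset.insert_subset_insert _ fun c hc => Finset.mem_erase.2 ⟨?_, hAB hc⟩
        rintro rfl
        exact haA hc
      · exact Finset.disjoint_insert_left.2
          ⟨hδS, hBS.2.mono_left (Finset.erase_subset _ _)⟩
      · ext c
        simp only [Finset.mem_sdiff, Finset.mem_insert, Finset.mem_erase, Finset.mem_singleton]
        constructor
        · rintro ⟨h | ⟨_, h⟩, h'⟩
          · exact h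
          · exact (h' h).elim
        · rintro rfl
          exact ⟨Or.inl rfl, hBS.1⟩

theorem arborescencesRightToLeft_spec [Fintype C] (hκ : G.head κ = r₀) :
    (∀ A, A ∈ G.arborescencesRightToLeft r₀ κ ↔ IsSpanningArborescence G.tail G.head r₀ A) ∧
      (G.arborescencesRightToLeft r₀ κ).Nodup ∧
      IsExchangeOrder (G.arborescencesRightToLeft r₀ κ) := by
  have h : IsArborescence G.tail G.head r₀ ∅ :=
    ⟨by simp, by simp, fun x hx => by
      rw [← (hx.iff_of_closed (P := fun y => r₀ = y) (by simp)).1 rfl]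
      exact Relation.ReflTransGen.refl⟩
  have := leavesFrom_spec hκ _ ∅ ∅ rfl h (tourCovers_empty hκ) (Finset.disjoint_empty_left _)
  simpa [leavesFrom, arborescencesRightToLeft, arborescenceTree] using this

end BipartiteMap

/-! ### Linear relations among the edge points. -/

namespace BipartiteMap

variable {E V C : Type*} (G : BipartiteMap E V C)

instance [Finite C] : Finite G.Region := Quotient.finite _

/-- The linear combinations of the points `𝐞 + 𝐯`, as a function of the coefficients. -/
noncomputable def edgeCombination [Fintype C] [DecidableEq E] [DecidableEq V] :
    (C → ℝ) →ₗ[ℝ] (E ⊕ V → ℝ) :=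
  Fintype.linearCombination ℝ G.edgePoint

/-- The coboundary of a function on the vertices of the dual graph. -/
def coboundary : (G.Region → ℝ) →ₗ[ℝ] (C → ℝ) where
  toFun h c := h (G.head c) - h (G.tail c)
  map_add' h h' := by ext; simp; ring
  map_smul' a h := by ext; simp; ring

variable {G}

theorem coboundary_apply (h : G.Region → ℝ) (c : C) :
    G.coboundary h c = h (G.head c) - h (G.tail c) := rfl

theorem edgeCombination_apply [Fintype C] [DecidableEq E] [DecidableEq V] (w : C → ℝ) :
    G.edgeCombination w = ∑ c, w c • G.edgePoint c := rfl

theorem edgePoint_inl [DecidableEq E] [DecidableEq V] (c : C) (e : E) :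
    G.edgePoint c (Sum.inl e) = if G.endE c = e then 1 else 0 := by
  simp [edgePoint, Pi.single_apply, eq_comm]

theorem edgePoint_inr [DecidableEq E] [DecidableEq V] (c : C) (v : V) :
    G.edgePoint c (Sum.inr v) = if G.endV c = v then 1 else 0 := by
  simp [edgePoint, Pi.single_apply, eq_comm]

theorem endE_rotE (c : C) : G.endE (G.rotE c) = G.endE c :=
  ((G.sameCycle_rotE c (G.rotE c)).1 ⟨1, by simp⟩).symm

theorem endV_rotV_symm (c : C) : G.endV (G.rotV.symm c) = G.endV c :=
  (G.sameCycle_rotV (G.rotV.symm c) c).1 ⟨1, by simp⟩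

theorem sum_coboundary [Fintype C] (h : G.Region → ℝ) : ∑ c, G.coboundary h c = 0 := by
  simp only [coboundary_apply, Finset.sum_sub_distrib, tail]
  rw [Equiv.sum_comp G.rotE fun c => h (G.head c), sub_self]

/-- Around each vertex of `G` the sum telescopes: the tail of `c` is the head of its neighbour `rotE
c`, or of `rotV.symm c`, at the same vertex. -/
theorem edgeCombination_coboundary [Fintype C] [DecidableEq E] [DecidableEq V] (h : G.Region → ℝ) :
    G.edgeCombination (G.coboundary h) = 0 := by
  ext (e | v)
  · simp only [edgeCombination_apply, coboundary_apply, Finset.sum_apply, Pi.smul_apply,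
      edgePoint_inl, smul_eq_mul, sub_mul, Finset.sum_sub_distrib, tail, Pi.zero_apply]
    rw [← Equiv.sum_comp G.rotE fun c => h (G.head c) * if G.endE c = e then 1 else 0]
    simp [endE_rotE]
  · simp only [edgeCombination_apply, coboundary_apply, Finset.sum_apply, Pi.smul_apply,
      edgePoint_inr, smul_eq_mul, sub_mul, Finset.sum_sub_distrib, tail_eq_head_rotV_symm,
      Pi.zero_apply]
    rw [← Equiv.sum_comp G.rotV.symm fun c => h (G.head c) * if G.endV c = v then 1 else 0]
    simp [endV_rotV_symm]

theorem le_of_reachableBy {r₀ : G.Region} {A : Finset C} {f : G.Region → ℝ}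
    (hf : ∀ c ∈ A, 0 ≤ G.coboundary f c) {x : G.Region}
    (hx : ReachableBy G.tail G.head A r₀ x) : f r₀ ≤ f x :=
  hx.of_closed (P := fun y => f r₀ ≤ f y)
    (fun c hc h => h.trans (sub_nonneg.1 (hf c hc))) le_rfl

variable [Fintype E] [Fintype V] [Fintype C]

/-- The dual graph of a connected graph is connected. -/
theorem IsConnectedPlane.eq_of_coboundary_eq_zero (hG : G.IsConnectedPlane) {h : G.Region → ℝ}
    (hh : G.coboundary h = 0) (x y : G.Region) : h x = h y := by
  have h1 : ∀ c, h (G.head c) = h (G.tail c) := fun c => sub_eq_zero.1 (congrFun hh c)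
  have hE : ∀ c d, G.endE c = G.endE d → h (G.head c) = h (G.head d) := by
    intro c d hcd
    obtain ⟨n, -, rfl⟩ := ((G.sameCycle_rotE c d).2 hcd).exists_pow_eq'
    clear hcd
    induction n with
    | zero => rfl
    | succ n ih => rw [ih, pow_succ']; exact h1 _
  have hV : ∀ c d, G.endV c = G.endV d → h (G.head c) = h (G.head d) := by
    intro c d hcd
    obtain ⟨n, -, rfl⟩ := ((G.sameCycle_rotV c d).2 hcd).exists_pow_eq'
    clear hcd
    induction n with
    | zero => rfl
    | succ n ih =>
      rw [ih, pow_succ', h1 ((G.rotV * G.rotV ^ n) c), tail_eq_head_rotV_symm]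
      simp
  obtain ⟨c, rfl⟩ : ∃ c, G.head c = x := Quotient.exists_rep x
  obtain ⟨d, rfl⟩ : ∃ d, G.head d = y := Quotient.exists_rep y
  have := (JoinedBy.iff_of_closed (P := Sum.elim
    (fun e => ∀ b, G.endE b = e → h (G.head c) = h (G.head b))
    (fun v => ∀ b, G.endV b = v → h (G.head c) = h (G.head b))) ?_
    (hG.connected (Sum.inl (G.endE c)) (Sum.inl (G.endE d)))).1 fun b hb => hE c b hb.symm
  · exact this d rfl
  · intro a _
    exact ⟨fun h b hb => (h a rfl).trans (hV a b hb.symm),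
      fun h b hb => (h a rfl).trans (hE a b hb.symm)⟩

/-- Some dual edge leaves any proper set of regions. -/
theorem IsConnectedPlane.exists_leaving_edge (hG : G.IsConnectedPlane) {T : Set G.Region}
    {x y : G.Region} (hx : x ∈ T) (hy : y ∉ T) : ∃ c, G.tail c ∈ T ∧ G.head c ∉ T := by
  classical
  by_contra! h
  -- If no edge leaves `T`, this coboundary is nonnegative; its sum is zero, so it vanishes and `f`
  -- is constant.
  set f : G.Region → ℝ := T.indicator 1 with hf
  have h0 : ∀ c, 0 ≤ G.coboundary f c := by
    intro c
    rw [coboundary_apply, sub_nonneg]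
    by_cases hc : G.tail c ∈ T
    · simp [hf, hc, h c hc]
    · simp only [hf, Set.indicator_of_notMem hc]
      exact Set.indicator_nonneg (fun _ _ => zero_le_one) _
  have h1 := (Finset.sum_eq_zero_iff_of_nonneg fun c _ => h0 c).1 (sum_coboundary f)
  have h2 := hG.eq_of_coboundary_eq_zero (h := f) (funext fun c => h1 c (Finset.mem_univ c)) x y
  simp [hf, hx, hy] at h2

variable [DecidableEq E] [DecidableEq V]

/-- One basis vector, added to the edge points, generates all the others along paths of `G`. -/
theorem IsConnectedPlane.card_le_finrank_range_add_one (hG : G.IsConnectedPlane) :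
    Fintype.card E + Fintype.card V ≤
      Module.finrank ℝ (LinearMap.range G.edgeCombination) + 1 := by
  rcases isEmpty_or_nonempty (E ⊕ V) with hEV | ⟨⟨x₀⟩⟩
  · rw [← Fintype.card_sum, Fintype.card_eq_zero]
    exact Nat.zero_le _
  set M := LinearMap.range G.edgeCombination ⊔ Submodule.span ℝ {Pi.single x₀ (1 : ℝ)} with hM
  have hmem : ∀ x : E ⊕ V, Pi.single x (1 : ℝ) ∈ M := by
    intro x
    refine (JoinedBy.iff_of_closed (P := fun x => Pi.single x (1 : ℝ) ∈ M) ?_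
      (hG.connected x₀ x)).1 (Submodule.mem_sup_right (Submodule.mem_span_singleton_self _))
    intro c _
    have hc : G.edgePoint c ∈ M := by
      classical
      refine Submodule.mem_sup_left ⟨Pi.single c 1, ?_⟩
      simp [edgeCombination]
    exact ⟨fun h => (M.add_mem_iff_right h).1 hc, fun h => (M.add_mem_iff_left h).1 hc⟩
  have htop : M = ⊤ := by
    rw [eq_top_iff]
    intro f _
    rw [pi_eq_sum_univ' f]
    refine M.sum_mem fun x _ => M.smul_mem _ ?_
    convert hmem x using 1
  calc Fintype.card E + Fintype.card V = Module.finrank ℝ M := by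
        rw [htop, finrank_top, Module.finrank_pi, Fintype.card_sum]
    _ ≤ _ := (Submodule.finrank_add_le_finrank_add_finrank _ _).trans
        (Nat.add_le_add_left ((finrank_span_le_card _).trans (by simp)) _)

/-- By connectedness the kernel has dimension at most $|C|-|E|-|V|+1$, and the coboundaries at least
the number of regions minus $1$. Euler's formula equates these bounds. -/
theorem IsConnectedPlane.ker_edgeCombination (hG : G.IsConnectedPlane) :
    LinearMap.ker G.edgeCombination = LinearMap.range G.coboundary := by
  classical
  have := Fintype.ofFinite G.Region
  symm
  refine Submodule.eq_of_le_of_finrank_le ?_ ?_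
  · rintro _ ⟨h, rfl⟩
    exact edgeCombination_coboundary h
  have h1 := hG.card_le_finrank_range_add_one
  have h2 := LinearMap.finrank_range_add_finrank_ker G.edgeCombination
  have h3 := LinearMap.finrank_range_add_finrank_ker G.coboundary
  have h4 : Module.finrank ℝ (LinearMap.ker G.coboundary) ≤ 1 := by
    refine (Submodule.finrank_mono (t := Submodule.span ℝ {fun _ => (1 : ℝ)}) ?_).trans
      ((finrank_span_le_card _).trans (by simp))
    intro h hh
    rcases isEmpty_or_nonempty G.Region with hR | ⟨⟨r⟩⟩
    · rw [Subsingleton.elim h 0]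
      exact Submodule.zero_mem _
    · refine Submodule.mem_span_singleton.2 ⟨h r, funext fun x => ?_⟩
      simp [hG.eq_of_coboundary_eq_zero hh x r]
  have h5 := hG.euler
  rw [Nat.card_eq_fintype_card] at h5
  rw [Module.finrank_pi] at h2 h3
  omega

theorem IsConnectedPlane.exists_coboundary (hG : G.IsConnectedPlane) {w w' : C → ℝ}
    (h : G.edgeCombination w = G.edgeCombination w') : ∃ f, G.coboundary f = w - w' := by
  have : w - w' ∈ LinearMap.ker G.edgeCombination := by simp [h]
  rwa [hG.ker_edgeCombination] at this

/-! ### Nonnegative coefficients that vanish on an arborescence: uniqueness and existence. -/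

variable {r₀ : G.Region}

/-- Nonnegative coefficients that vanish on spanning arborescences are determined by the linear
combination. -/
theorem IsConnectedPlane.coefficients_unique (hG : G.IsConnectedPlane) {A B : Finset C}
    (hA : ∀ x, ReachableBy G.tail G.head A r₀ x) (hB : ∀ x, ReachableBy G.tail G.head B r₀ x)
    {w w' : C → ℝ} (hw : 0 ≤ w) (hw' : 0 ≤ w') (hwA : ∀ c ∈ A, w c = 0)
    (hwB : ∀ c ∈ B, w' c = 0) (h : G.edgeCombination w = G.edgeCombination w') : w = w' := by
  obtain ⟨f, hf⟩ := hG.exists_coboundary h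
  -- The potential `f` of `w - w'` does not decrease along `B`, where `w'` vanishes, and does not
  -- increase along `A`.
  have h1 : ∀ x, f r₀ ≤ f x := fun x => le_of_reachableBy (fun c hc => by
    rw [hf, Pi.sub_apply, hwB c hc, sub_zero]; exact hw c) (hB x)
  have h2 : ∀ x, (-f) r₀ ≤ (-f) x := fun x => le_of_reachableBy (fun c hc => by
    rw [map_neg, hf, Pi.neg_apply, Pi.sub_apply, hwA c hc, zero_sub, neg_neg]; exact hw' c) (hA x)
  have h3 : ∀ x, f x = f r₀ := fun x => le_antisymm (neg_le_neg_iff.1 (h2 x)) (h1 x)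
  refine sub_eq_zero.1 (hf.symm.trans (funext fun c => ?_))
  simp [coboundary_apply, h3]

theorem IsConnectedPlane.eq_zero_of_edgeCombination (hG : G.IsConnectedPlane) {A : Finset C}
    (hA : ∀ x, ReachableBy G.tail G.head A r₀ x) {w : C → ℝ} (hwA : ∀ c ∈ A, w c = 0)
    (h : G.edgeCombination w = 0) : w = 0 := by
  obtain ⟨f, hf⟩ := hG.exists_coboundary (h.trans (map_zero _).symm)
  rw [sub_zero] at hf
  have h1 : ∀ x, f r₀ ≤ f x := fun x => le_of_reachableBy (fun c hc => by
    rw [hf, hwA c hc]) (hA x)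
  have h2 : ∀ x, (-f) r₀ ≤ (-f) x := fun x => le_of_reachableBy (fun c hc => by
    rw [map_neg, hf, Pi.neg_apply, hwA c hc, neg_zero]) (hA x)
  have h3 : ∀ x, f x = f r₀ := fun x => le_antisymm (neg_le_neg_iff.1 (h2 x)) (h1 x)
  rw [← hf]
  ext c
  simp [coboundary_apply, h3]

/-- Every nonnegative linear combination may be rewritten so that the coefficients stay nonnegative
and those that vanish contain a spanning arborescence: the coefficients are lengths of dual edges,
which are changed by the coboundary of the distance from `r₀`. -/
theorem IsConnectedPlane.exists_tight (hG : G.IsConnectedPlane) [DecidableEq C] (r₀ : G.Region)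
    {w : C → ℝ} (hw : 0 ≤ w) :
    ∃ w' : C → ℝ, 0 ≤ w' ∧ G.edgeCombination w' = G.edgeCombination w ∧ ∑ c, w' c = ∑ c, w c ∧
      ∃ A : Finset C, IsSpanningArborescence G.tail G.head r₀ A ∧ ∀ c ∈ A, w' c = 0 := by
  classical
  generalize hn : {x | ¬ ReachableBy G.tail G.head ({c | w c = 0} : Finset C) r₀ x}.ncard = n
  induction n using Nat.strong_induction_on generalizing w with
  | h n ih =>
  set F : Finset C := {c | w c = 0} with hF
  by_cases hall : ∀ x, ReachableBy G.tail G.head F r₀ x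
  · obtain ⟨A, hAF, hA⟩ := exists_isSpanningArborescence_subset hall
    exact ⟨w, hw, rfl, rfl, A, hA, fun c hc => (Finset.mem_filter.1 (hAF hc)).2⟩
  push Not at hall
  obtain ⟨y, hy⟩ := hall
  set T : Set G.Region := {x | ReachableBy G.tail G.head F r₀ x} with hT
  have hr₀ : r₀ ∈ T := Relation.ReflTransGen.refl
  set L : Finset C := {c | G.tail c ∈ T ∧ G.head c ∉ T} with hL
  have hLne : L.Nonempty := by
    obtain ⟨c, hc⟩ := hG.exists_leaving_edge hr₀ hy
    exact ⟨c, by simpa [hL] using hc⟩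
  obtain ⟨m, hmL, hm⟩ := L.exists_min_image w hLne
  have hmT : G.tail m ∈ T ∧ G.head m ∉ T := by simpa [hL] using hmL
  -- One step of Dijkstra's algorithm: edges leaving `T` are shortened by the least of their
  -- lengths, entering ones are lengthened, all others are unchanged. So `m` gets length zero and
  -- `G.head m` becomes reachable.
  set f : G.Region → ℝ := T.indicator fun _ => w m with hf
  set w' := w + G.coboundary f with hw'
  have hfT : ∀ x ∈ T, f x = w m := fun x hx => Set.indicator_of_mem hx _
  have hfT' : ∀ x ∉ T, f x = 0 := fun x hx => Set.indicator_of_notMem hx _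
  have hw'c : ∀ c, w' c = w c + (f (G.head c) - f (G.tail c)) := fun c => rfl
  have hpos : 0 ≤ w' := by
    intro c
    rw [hw'c, Pi.zero_apply]
    have hwc : 0 ≤ w c := hw c
    have hwm : 0 ≤ w m := hw m
    by_cases h1 : G.tail c ∈ T <;> by_cases h2 : G.head c ∈ T
    · rw [hfT _ h1, hfT _ h2]; linarith
    · rw [hfT _ h1, hfT' _ h2]
      linarith [hm c (by simpa [hL] using ⟨h1, h2⟩)]
    · rw [hfT' _ h1, hfT _ h2]; linarith
    · rw [hfT' _ h1, hfT' _ h2]; linarith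
  set F' : Finset C := {c | w' c = 0} with hF'
  have hTF' : ∀ x ∈ T, ReachableBy G.tail G.head F' r₀ x := by
    intro x hx
    refine (hx.of_closed (P := fun y => y ∈ T ∧ ReachableBy G.tail G.head F' r₀ y) ?_
      ⟨hr₀, Relation.ReflTransGen.refl⟩).2
    rintro c hc ⟨h1, h2⟩
    have h3 : G.head c ∈ T := ReachableBy.step h1 hc
    refine ⟨h3, h2.step ?_⟩
    have hc0 : w c = 0 := (Finset.mem_filter.1 hc).2
    simp [hF', hw'c, hfT _ h1, hfT _ h3, hc0]
  have hm' : ReachableBy G.tail G.head F' r₀ (G.head m) := by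
    refine (hTF' _ hmT.1).step ?_
    simp [hF', hw'c, hfT _ hmT.1, hfT' _ hmT.2]
  have hlt : {x | ¬ ReachableBy G.tail G.head F' r₀ x}.ncard < n := by
    rw [← hn]
    refine Set.ncard_lt_ncard ⟨fun x hx hxT => hx (hTF' x hxT), fun h => ?_⟩ (Set.toFinite _)
    exact h (show G.head m ∈ _ from hmT.2) hm'
  obtain ⟨w'', h0, h1, h2, A, hA⟩ := ih _ hlt hpos rfl
  refine ⟨w'', h0, h1.trans ?_, h2.trans ?_, A, hA⟩
  · rw [hw', map_add, edgeCombination_coboundary, add_zero]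
  · rw [hw']
    simp only [Pi.add_apply, Finset.sum_add_distrib, sum_coboundary, add_zero]

end BipartiteMap

/-! ### The simplices, the triangulation and the shelling. -/

namespace BipartiteMap

variable {E V C : Type*} [DecidableEq E] [DecidableEq V] {G : BipartiteMap E V C}

/-- The edge points are vertices of the unit cube, which contains the root polytope. -/
theorem edgePoint_mem_extremePoints (c : C) :
    G.edgePoint c ∈ Set.extremePoints ℝ G.rootPolytope := by
  have h01 : ∀ d x, G.edgePoint d x = 0 ∨ G.edgePoint d x = 1 := by
    rintro d (e | v)
    · rw [edgePoint_inl]; split_ifs <;> simp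
    · rw [edgePoint_inr]; split_ifs <;> simp
  have hcube : G.rootPolytope ⊆ Set.Icc 0 1 := by
    refine convexHull_min ?_ (convex_Icc _ _)
    rintro _ ⟨d, rfl⟩
    exact ⟨fun x => by rcases h01 d x with h | h <;> simp [h],
      fun x => by rcases h01 d x with h | h <;> simp [h]⟩
  rw [mem_extremePoints_iff_left]
  refine ⟨subset_convexHull ℝ _ ⟨c, rfl⟩, ?_⟩
  rintro p hp q hq ⟨a, b, ha, hb, hab, h⟩
  obtain ⟨hp0, hp1⟩ := hcube hp
  obtain ⟨hq0, hq1⟩ := hcube hq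
  ext x
  have hx := congrFun h x
  simp only [Pi.add_apply, Pi.smul_apply, smul_eq_mul] at hx
  have h1 : 0 ≤ p x := hp0 x
  have h2 : p x ≤ 1 := hp1 x
  have h3 : 0 ≤ q x := hq0 x
  have h4 : q x ≤ 1 := hq1 x
  rcases h01 c x with h0 | h0 <;> rw [h0] at hx ⊢
  · have : a * p x ≤ 0 := by nlinarith [mul_nonneg hb.le h3]
    exact le_antisymm (nonpos_of_mul_nonpos_right this ha) h1
  · have : a * (1 - p x) ≤ 0 := by nlinarith [mul_nonneg hb.le (sub_nonneg.2 h4)]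
    linarith [nonpos_of_mul_nonpos_right this ha]

variable [Fintype E] [Fintype V] [Fintype C] [DecidableEq C]

theorem dualSimplex_anti {A B : Finset C} (h : A ⊆ B) : G.dualSimplex B ⊆ G.dualSimplex A :=
  Finset.image_subset_image (Finset.compl_subset_compl.2 h)

theorem mem_convexHull_dualSimplex {A : Finset C} {q : E ⊕ V → ℝ} :
    q ∈ convexHull ℝ (G.dualSimplex A : Set (E ⊕ V → ℝ)) ↔
      ∃ w : C → ℝ, 0 ≤ w ∧ ∑ c, w c = 1 ∧ (∀ c ∈ A, w c = 0) ∧ G.edgeCombination w = q := by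
  constructor
  · set K : Set (C → ℝ) := {w | 0 ≤ w ∧ ∑ c, w c = 1 ∧ ∀ c ∈ A, w c = 0} with hK
    have hconv : Convex ℝ K := by
      rintro w ⟨h1, h2, h3⟩ w' ⟨h1', h2', h3'⟩ a b ha hb hab
      refine ⟨fun c => ?_, ?_, fun c hc => ?_⟩
      · exact add_nonneg (mul_nonneg ha (h1 c)) (mul_nonneg hb (h1' c))
      · simp [Finset.sum_add_distrib, ← Finset.mul_sum, h2, h2', hab]
      · simp [h3 c hc, h3' c hc]
    intro hq
    have hsub : (G.dualSimplex A : Set (E ⊕ V → ℝ)) ⊆ G.edgeCombination '' K := by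
      intro p hp
      obtain ⟨c, hc, rfl⟩ := Finset.mem_image.1 (Finset.mem_coe.1 hp)
      refine ⟨Pi.single c 1, ⟨?_, by simp, fun d hd => ?_⟩, by simp [edgeCombination]⟩
      · exact Pi.single_nonneg.2 zero_le_one
      · exact Pi.single_eq_of_ne (ne_of_mem_of_not_mem hd (Finset.mem_compl.1 hc)) _
    obtain ⟨w, ⟨h1, h2, h3⟩, h⟩ := convexHull_min hsub (hconv.linear_image _) hq
    exact ⟨w, h1, h2, h3, h⟩
  · rintro ⟨w, h1, h2, h3, rfl⟩
    have hs : ∀ c, c ∉ Aᶜ → w c = 0 := fun c hc => h3 c (by simpa using hc)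
    rw [edgeCombination_apply, ← Finset.sum_subset (Finset.subset_univ Aᶜ)
      fun c _ hc => by rw [hs c hc, zero_smul]]
    refine (convex_convexHull ℝ _).sum_mem (fun c _ => h1 c) ?_
      fun c hc => subset_convexHull ℝ _ (Finset.mem_coe.2 (Finset.mem_image_of_mem _ hc))
    rw [Finset.sum_subset (Finset.subset_univ Aᶜ) fun c _ hc => hs c hc, h2]

theorem convexHull_dualSimplex_empty :
    convexHull ℝ (G.dualSimplex ∅ : Set (E ⊕ V → ℝ)) = G.rootPolytope := by
  simp [dualSimplex, rootPolytope]

variable {r₀ : G.Region} {A B : Finset C}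

theorem IsConnectedPlane.convexHull_inter (hG : G.IsConnectedPlane)
    (hA : IsSpanningArborescence G.tail G.head r₀ A)
    (hB : IsSpanningArborescence G.tail G.head r₀ B) :
    convexHull ℝ (G.dualSimplex A : Set (E ⊕ V → ℝ)) ∩ convexHull ℝ (G.dualSimplex B) =
      convexHull ℝ (G.dualSimplex (A ∪ B)) := by
  refine Set.Subset.antisymm ?_ (Set.subset_inter
    (convexHull_mono (dualSimplex_anti Finset.subset_union_left))
    (convexHull_mono (dualSimplex_anti Finset.subset_union_right)))
  rintro q ⟨hqA, hqB⟩
  obtain ⟨w, h1, h2, h3, rfl⟩ := mem_convexHull_dualSimplex.1 hqA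
  obtain ⟨w', h1', h2', h3', h'⟩ := mem_convexHull_dualSimplex.1 hqB
  obtain rfl := hG.coefficients_unique hA.reachableBy hB.reachableBy h1 h1' h3 h3' h'.symm
  refine mem_convexHull_dualSimplex.2 ⟨w, h1, h2, fun c hc => ?_, rfl⟩
  exact (Finset.mem_union.1 hc).elim (h3 c) (h3' c)

/-- Parallel edges have equal points, so this is needed to recover arborescences from their
simplices and to count vertices. It is uniqueness of coefficients, applied to unit vectors. -/
theorem IsConnectedPlane.edgePoint_inj (hG : G.IsConnectedPlane)
    (hA : IsSpanningArborescence G.tail G.head r₀ A)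
    (hB : IsSpanningArborescence G.tail G.head r₀ B) {c d : C} (hc : c ∉ A) (hd : d ∉ B)
    (h : G.edgePoint c = G.edgePoint d) : c = d := by
  have hsingle : ∀ {D : Finset C} {b : C}, b ∉ D → ∀ a ∈ D, (Pi.single b 1 : C → ℝ) a = 0 :=
    fun hb a ha => Pi.single_eq_of_ne (ne_of_mem_of_not_mem ha hb) _
  have := hG.coefficients_unique hA.reachableBy hB.reachableBy
    (Pi.single_nonneg.2 zero_le_one) (Pi.single_nonneg.2 zero_le_one) (hsingle hc) (hsingle hd)
    (by simpa [edgeCombination] using h)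
  by_contra hne
  have h1 := congrFun this c
  rw [Pi.single_eq_same, Pi.single_eq_of_ne hne] at h1
  exact one_ne_zero h1

theorem IsConnectedPlane.dualSimplex_inj (hG : G.IsConnectedPlane)
    (hA : IsSpanningArborescence G.tail G.head r₀ A)
    (hB : IsSpanningArborescence G.tail G.head r₀ B) (h : G.dualSimplex A = G.dualSimplex B) :
    A = B := by
  have key : ∀ {A B : Finset C}, IsSpanningArborescence G.tail G.head r₀ A →
      IsSpanningArborescence G.tail G.head r₀ B → G.dualSimplex A = G.dualSimplex B → B ⊆ A := by
    intro A B hA hB h c hcB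
    by_contra hcA
    have : G.edgePoint c ∈ G.dualSimplex B :=
      h ▸ Finset.mem_image_of_mem _ (Finset.mem_compl.2 hcA)
    obtain ⟨d, hd, hdc⟩ := Finset.mem_image.1 this
    rw [Finset.mem_compl] at hd
    exact hd (hG.edgePoint_inj hA hB hcA hd hdc.symm ▸ hcB)
  exact (key hB hA h.symm).antisymm (key hA hB h)

theorem IsConnectedPlane.card_dualSimplex (hG : G.IsConnectedPlane)
    (hA : IsSpanningArborescence G.tail G.head r₀ A) (hAB : A ⊆ B) :
    (G.dualSimplex B).card = Bᶜ.card :=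
  Finset.card_image_of_injOn fun _ hc _ hd h => hG.edgePoint_inj hA hA
    (fun h => Finset.mem_compl.1 hc (hAB h)) (fun h => Finset.mem_compl.1 hd (hAB h)) h

theorem IsConnectedPlane.affineIndependent (hG : G.IsConnectedPlane)
    (hA : IsSpanningArborescence G.tail G.head r₀ A) :
    AffineIndependent ℝ (fun p : G.dualSimplex A => (p : E ⊕ V → ℝ)) := by
  have h : LinearIndepOn ℝ G.edgePoint (Aᶜ : Finset C) := by
    rw [linearIndepOn_finset_iff]
    intro f hf c hc
    set w : C → ℝ := fun c => if c ∈ A then 0 else f c with hw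
    have hw0 : w = 0 := by
      refine hG.eq_zero_of_edgeCombination hA.reachableBy (fun c hc => if_pos hc) ?_
      rw [← hf, edgeCombination_apply, ← Finset.sum_subset (Finset.subset_univ Aᶜ)
        fun c _ hc => by rw [hw]; simp_all]
      refine Finset.sum_congr rfl fun c hc => ?_
      rw [hw]
      simp_all
    have := congrFun hw0 c
    simp_all
  have h' := h.id_image
  rw [← Finset.coe_image] at h'
  exact LinearIndependent.affineIndependent (k := ℝ) h'

/-- For `c ∈ A`, the coboundary of the root component of `A.erase c` is $-1$ at `c`, zero on the
rest of `A`, and has sum $0$: it moves the unit coefficient of `c` to edges outside `A`. -/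
theorem edgePoint_mem_affineSpan
    (hA : IsSpanningArborescence G.tail G.head r₀ A) (c : C) :
    G.edgePoint c ∈ affineSpan ℝ (G.dualSimplex A : Set (E ⊕ V → ℝ)) := by
  classical
  have key : ∀ w : C → ℝ, ∑ c, w c = 1 → (∀ c ∈ A, w c = 0) →
      G.edgeCombination w ∈ affineSpan ℝ (G.dualSimplex A : Set (E ⊕ V → ℝ)) := by
    intro w h1 hw
    have hs : ∀ c, c ∉ Aᶜ → w c = 0 := fun c hc => hw c (by simpa using hc)
    have h1' : ∑ c : (Aᶜ : Finset C), w c = 1 := by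
      rw [Finset.sum_coe_sort Aᶜ w,
        Finset.sum_subset (Finset.subset_univ Aᶜ) fun c _ hc => hs c hc, h1]
    have h2 := affineCombination_mem_affineSpan (k := ℝ) h1'
      (fun c : (Aᶜ : Finset C) => G.edgePoint c)
    rw [Finset.affineCombination_eq_linear_combination _ _ _ h1',
      Finset.sum_coe_sort Aᶜ fun c => w c • G.edgePoint c,
      Finset.sum_subset (Finset.subset_univ Aᶜ) fun c _ hc => by rw [hs c hc, zero_smul]] at h2
    refine affineSpan_mono ℝ ?_ h2
    rintro _ ⟨c, rfl⟩
    exact Finset.mem_coe.2 (Finset.mem_image_of_mem _ c.2)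
  have hp : G.edgeCombination (Pi.single c 1) = G.edgePoint c := by simp [edgeCombination]
  by_cases hc : c ∈ A
  · set T : Set G.Region := {x | JoinedBy G.tail G.head (A.erase c) r₀ x} with hT
    obtain ⟨hs, ht⟩ := hA.joinedBy_erase hc
    set f : G.Region → ℝ := T.indicator 1 with hf
    rw [← hp, ← add_zero (G.edgeCombination _), ← edgeCombination_coboundary f, ← map_add]
    refine key _ ?_ fun a ha => ?_
    · simp [Finset.sum_add_distrib, sum_coboundary]
    rw [Pi.add_apply, coboundary_apply]
    by_cases hac : a = c
    · subst hac
      rw [hf, Set.indicator_of_mem (show G.tail a ∈ T from hs),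
        Set.indicator_of_notMem (show G.head a ∉ T from ht)]
      simp
    · have hj := joinedBy_iff_of_mem (s := G.tail) (t := G.head) (r := r₀)
        (Finset.mem_erase.2 ⟨hac, ha⟩)
      have : f (G.head a) = f (G.tail a) := by
        simp only [hf, Set.indicator_apply, hT, Set.mem_ofPred_eq, hj, Pi.one_apply]
      rw [this, sub_self, add_zero, Pi.single_eq_of_ne hac]
  · rw [← hp]
    exact key _ (by simp) fun a ha => Pi.single_eq_of_ne (ne_of_mem_of_not_mem ha hc) _

theorem IsConnectedPlane.card_dualSimplex_eq_finrank (hG : G.IsConnectedPlane)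
    (hA : IsSpanningArborescence G.tail G.head r₀ A) :
    (G.dualSimplex A).card = Module.finrank ℝ (vectorSpan ℝ G.rootPolytope) + 1 := by
  have hspan : affineSpan ℝ (G.dualSimplex A : Set (E ⊕ V → ℝ)) = affineSpan ℝ G.rootPolytope := by
    rw [rootPolytope, affineSpan_convexHull]
    refine le_antisymm (affineSpan_mono ℝ ?_) (affineSpan_le.2 ?_)
    · intro p hp
      obtain ⟨c, -, rfl⟩ := Finset.mem_image.1 (Finset.mem_coe.1 hp)
      exact ⟨c, rfl⟩
    · rintro _ ⟨c, rfl⟩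
      exact edgePoint_mem_affineSpan hA c
  -- A region is a class of edges, so `r₀` provides an edge of `G`.
  obtain ⟨c, -⟩ := Quotient.exists_rep r₀
  have hne : Nonempty (G.dualSimplex A) := by
    by_contra h
    rw [not_nonempty_iff, Finset.isEmpty_coe_sort] at h
    have := edgePoint_mem_affineSpan hA c
    rw [h, Finset.coe_empty, AffineSubspace.span_empty] at this
    exact AffineSubspace.notMem_bot ℝ _ _ this
  have h := (hG.affineIndependent hA).finrank_vectorSpan_add_one
  rw [Fintype.card_coe] at h
  rw [Subtype.range_coe_subtype, Finset.setOfPred_mem] at h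
  rw [← h, ← direction_affineSpan, ← direction_affineSpan, ← hspan]

theorem IsConnectedPlane.isTriangulation (hG : G.IsConnectedPlane) (r₀ : G.Region) :
    IsTriangulation G.rootPolytope (G.arborescenceSimplices r₀) where
  affineIndependent := by
    rintro _ ⟨A, hA, rfl⟩
    exact hG.affineIndependent hA
  card_eq := by
    rintro _ ⟨A, hA, rfl⟩
    exact hG.card_dualSimplex_eq_finrank hA
  vertices := by
    rintro _ ⟨A, hA, rfl⟩ p hp
    obtain ⟨c, -, rfl⟩ := Finset.mem_image.1 (Finset.mem_coe.1 hp)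
    exact edgePoint_mem_extremePoints c
  union_eq := by
    rw [← convexHull_dualSimplex_empty]
    refine Set.Subset.antisymm (Set.iUnion₂_subset ?_) fun q hq => ?_
    · rintro _ ⟨A, hA, rfl⟩
      exact convexHull_mono (dualSimplex_anti (Finset.empty_subset A))
    · obtain ⟨w, h1, h2, -, rfl⟩ := mem_convexHull_dualSimplex.1 hq
      obtain ⟨w', h1', hq', h2', A, hA, hwA⟩ := hG.exists_tight r₀ h1
      exact Set.mem_iUnion₂.2 ⟨_, ⟨A, hA, rfl⟩,
        mem_convexHull_dualSimplex.2 ⟨w', h1', h2'.trans h2, hwA, hq'⟩⟩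
  inter_eq := by
    rintro _ ⟨A, hA, rfl⟩ _ ⟨B, hB, rfl⟩
    exact ⟨G.dualSimplex (A ∪ B), dualSimplex_anti Finset.subset_union_left,
      dualSimplex_anti Finset.subset_union_right, hG.convexHull_inter hA hB⟩

theorem IsConnectedPlane.isShellingOrder (hG : G.IsConnectedPlane) {L : List (Finset C)}
    (hL : ∀ A, A ∈ L ↔ IsSpanningArborescence G.tail G.head r₀ A) (hnodup : L.Nodup)
    (hex : IsExchangeOrder L) :
    IsShellingOrder (G.arborescenceSimplices r₀) (L.map G.dualSimplex) where
  nodup := hnodup.map_on fun A hA B hB h => hG.dualSimplex_inj ((hL A).1 hA) ((hL B).1 hB) h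
  mem_iff a := by
    simp only [List.mem_map, hL]
    rfl
  inter_eq i hi h0 := by
    classical
    rw [List.length_map] at hi
    simp only [List.getElem_map]
    have hs : ∀ (j : ℕ) (hj : j < L.length), IsSpanningArborescence G.tail G.head r₀ L[j] :=
      fun j hj => (hL _).1 (List.getElem_mem hj)
    -- For `δ ∈ D`, the facet of the `i`-th simplex opposite to `δ` is its whole intersection with
    -- an earlier one; the exchange property puts all other earlier intersections inside such
    -- facets.
    set D : Finset C := {δ | ∃ (k : ℕ) (hk : k < i), L[k] \ L[i] = {δ}} with hD
    have hDmem : ∀ δ, δ ∈ D ↔ ∃ (k : ℕ) (hk : k < i), L[k] \ L[i] = {δ} := by simp [hD]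
    refine ⟨D.image fun δ => G.dualSimplex (insert δ L[i]), ?_, ?_, ?_⟩
    · obtain ⟨k, hk, δ, -, h⟩ := hex i hi 0 h0
      exact ⟨_, Finset.mem_image_of_mem _ ((hDmem δ).2 ⟨k, hk, h⟩)⟩
    · intro f hf
      obtain ⟨δ, hδ, rfl⟩ := Finset.mem_image.1 hf
      obtain ⟨k, hk, h⟩ := (hDmem δ).1 hδ
      have hδi : δ ∉ L[i] := (Finset.mem_sdiff.1 (h ▸ Finset.mem_singleton_self δ)).2
      refine ⟨dualSimplex_anti (Finset.subset_insert _ _), ?_⟩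
      rw [hG.card_dualSimplex (hs i hi) (Finset.subset_insert _ _),
        hG.card_dualSimplex (hs i hi) subset_rfl, Finset.compl_insert,
        Finset.card_erase_add_one (Finset.mem_compl.2 hδi)]
    · ext q
      simp only [Set.mem_inter_iff, Set.mem_iUnion, Finset.mem_image, exists_prop]
      constructor
      · rintro ⟨hq, j, hj, hqj⟩
        obtain ⟨k, hk, δ, hδ, h⟩ := hex i hi j hj
        refine ⟨_, ⟨δ, (hDmem δ).2 ⟨k, hk, h⟩, rfl⟩, ?_⟩
        have hq' := (hG.convexHull_inter (hs i hi) (hs j (hj.trans hi))).subset ⟨hq, hqj⟩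
        exact convexHull_mono (dualSimplex_anti (Finset.insert_subset
          (Finset.mem_union_right _ hδ) Finset.subset_union_left)) hq'
      · rintro ⟨_, ⟨δ, hδ, rfl⟩, hq⟩
        obtain ⟨k, hk, h⟩ := (hDmem δ).1 hδ
        refine ⟨convexHull_mono (dualSimplex_anti (Finset.subset_insert _ _)) hq, k, hk,
          convexHull_mono (dualSimplex_anti ?_) hq⟩
        rw [← Finset.union_singleton, ← h]
        exact fun c hc => by simp [hc]

end BipartiteMap

theorem theorem5p1 {E V C : Type*} [Fintype E] [Fintype V] [Fintype C]
    [DecidableEq E] [DecidableEq V] [DecidableEq C]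
    (G : BipartiteMap E V C) (hG : G.IsConnectedPlane) (r₀ : G.Region) :
    IsTriangulation G.rootPolytope (G.arborescenceSimplices r₀) ∧
    (∀ κ : C, G.head κ = r₀ →
      IsShellingOrder (G.arborescenceSimplices r₀)
        ((G.arborescencesRightToLeft r₀ κ).map G.dualSimplex)) ∧
    IsShellable (G.arborescenceSimplices r₀) := by
  have h : ∀ κ : C, G.head κ = r₀ → IsShellingOrder (G.arborescenceSimplices r₀)
      ((G.arborescencesRightToLeft r₀ κ).map G.dualSimplex) := by
    intro κ hκ
    obtain ⟨hL, hnodup, hex⟩ := BipartiteMap.arborescencesRightToLeft_spec hκ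
    exact hG.isShellingOrder hL hnodup hex
  obtain ⟨κ, hκ⟩ : ∃ κ, G.head κ = r₀ := Quotient.exists_rep r₀
  exact ⟨hG.isTriangulation r₀, h, _, h κ hκ⟩
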